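/- Let $A$ be an associative ring with unit, let $\pi$ be a group, and let $A\pi$ be the group ring, with augmentation $\epsilon:A\pi\to A$, $\epsilon(a)=a$ for $a\in A$ and $\epsilon(g)=1$ for $g\in\pi$. Let $\Sigma$ be the set of square matrices $\sigma$ over $A\pi$ such that $\epsilon(\sigma)$ is invertible over $A$, let $i_\Sigma:A\pi\to\Sigma^{-1}A\pi$ be the universal localization (the universal ring homomorphism from $A\pi$ that makes every matrix in $\Sigma$ invertible), and let $\epsilon_\Sigma:\Sigma^{-1}A\pi\to A$ be the unique ring homomorphism with $\epsilon_\Sigma i_\Sigma=\epsilon$. For a ring $R$ let $K_1(R)=\mathrm{GL}(R)^{\mathrm{ab}}$, where $\mathrm{GL}(R)=\varinjlim \mathrm{GL}_n(R)$. Then every element of $\epsilon_\Sigma^{-1}(1)$ is a unit of $\Sigma^{-1}A\pi$, so that $\epsilon_\Sigma^{-1}(1)$ is a group under multiplication. Let $C$ be its (normal) subgroup generated by $$\{(1+ab)(1+ba)^{-1}\mid a,b\in\Sigma^{-1}A\pi,\ \epsilon_\Sigma(ab)=\epsilon_\Sigma(ba)=0\}.$$ There is a canonical isomorphism of groups $$K_1(\Sigma^{-1}A\pi)\;\cong\;K_1(A)\oplus\frac{\epsilon_\Sigma^{-1}(1)}{C}.$$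 Here canonical means that its inverse restricts to the map $K_1(A)\to K_1(\Sigma^{-1}A\pi)$ induced by $A\to A\pi\to\Sigma^{-1}A\pi$ on the first summand, and to the map sending the class of a unit $u\in\epsilon_\Sigma^{-1}(1)$ to the class $[u]\in K_1(\Sigma^{-1}A\pi)$ of the $1\times1$ matrix $(u)$ on the second. -/

import Mathlib

namespace GroupRingK1

noncomputable section

/-! ### The group `K₁` of an associative ring -/

section K1

/-- Block sum `M ⊕ 1` of an `n × n` matrix with an identity matrix, as an `m × m` matrix. -/
def stabMatrix {R : Type*} [Ring R] (n m : ℕ) (M : Matrix (Fin n) (Fin n) R) :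
    Matrix (Fin m) (Fin m) R :=
  Matrix.of fun i j =>
    if h : (i : ℕ) < n ∧ (j : ℕ) < n then M ⟨i, h.1⟩ ⟨j, h.2⟩ else if i = j then 1 else 0

theorem stabMatrix_one {R : Type*} [Ring R] (n m : ℕ) :
    stabMatrix n m (1 : Matrix (Fin n) (Fin n) R) = 1 := by
  ext i j
  by_cases h : (i : ℕ) < n ∧ (j : ℕ) < n <;>
    simp [stabMatrix, Matrix.one_apply, Fin.ext_iff]

theorem stabMatrix_eq {R : Type*} [Ring R] (n d : ℕ) (M : Matrix (Fin n) (Fin n) R) :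
    stabMatrix n (n + d) M =
      Matrix.reindex finSumFinEquiv finSumFinEquiv (Matrix.fromBlocks M 0 0 1) := by
  ext i j
  refine Fin.addCases (fun i => ?_) (fun i => ?_) i <;>
    refine Fin.addCases (fun j => ?_) (fun j => ?_) j
  · simp [stabMatrix]
  · have : (i : ℕ) ≠ n + j := by have := i.2; omega
    simp [stabMatrix, Fin.ext_iff, this]
  · have : n + (i : ℕ) ≠ j := by have := j.2; omega
    simp [stabMatrix, Fin.ext_iff, this]
  · simp [stabMatrix, Matrix.one_apply]

theorem stabMatrix_mul {R : Type*} [Ring R] {n m : ℕ} (hnm : n ≤ m)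
    (M N : Matrix (Fin n) (Fin n) R) :
    stabMatrix n m (M * N) = stabMatrix n m M * stabMatrix n m N := by
  obtain ⟨d, rfl⟩ := Nat.exists_eq_add_of_le hnm
  simp only [stabMatrix_eq, Matrix.reindex_apply]
  rw [Matrix.submatrix_mul_equiv, Matrix.fromBlocks_multiply]
  simp

/-- The stabilization homomorphism `GL_n(R) → GL_m(R)`, `g ↦ g ⊕ 1`, for `n ≤ m`. -/
def stab (R : Type*) [Ring R] (n m : ℕ) (h : n ≤ m) :
    (Matrix (Fin n) (Fin n) R)ˣ →* (Matrix (Fin m) (Fin m) R)ˣ :=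
  Units.map
    { toFun := stabMatrix n m
      map_one' := stabMatrix_one n m
      map_mul' := stabMatrix_mul h }

instance stab_directedSystem (R : Type*) [Ring R] :
    DirectedSystem (fun n : ℕ => (Matrix (Fin n) (Fin n) R)ˣ) (fun n m h => stab R n m h) where
  map_self n g := by
    ext i j
    simp [stab, stabMatrix]
  map_map := by
    intro k n m h₁ h₂ g
    ext i j
    simp only [stab, stabMatrix, Units.coe_map, MonoidHom.coe_mk, OneHom.coe_mk, Matrix.of_apply]
    by_cases hn : (i : ℕ) < n ∧ (j : ℕ) < n
    · simp [hn, Fin.ext_iff]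
    · have hm : ¬ ((i : ℕ) < m ∧ (j : ℕ) < m) := fun h => hn ⟨by omega, by omega⟩
      rw [dif_neg hn, dif_neg hm]

/-- The stable general linear group `GL(R) = colim GL_n(R)`. -/
abbrev StableGL (R : Type*) [Ring R] : Type _ :=
  DirectLimit (fun n : ℕ => (Matrix (Fin n) (Fin n) R)ˣ) (stab R)

/-- The canonical map `GL_n(R) → GL(R)`. -/
def StableGL.of (R : Type*) [Ring R] (n : ℕ) :
    (Matrix (Fin n) (Fin n) R)ˣ →* StableGL R where
  toFun g := ⟦⟨n, g⟩⟧
  map_one' := (DirectLimit.one_def n).symm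
  map_mul' g h := (DirectLimit.mul_def (f := stab R) n g h).symm

/-- The map `GL(R) → GL(S)` induced by a ring homomorphism, applied entrywise. -/
def StableGL.map {R S : Type*} [Ring R] [Ring S] (f : R →+* S) : StableGL R →* StableGL S where
  toFun := DirectLimit.map (stab R) (stab S)
    (fun n => Units.map (f.mapMatrix : Matrix (Fin n) (Fin n) R →+* Matrix (Fin n) (Fin n) S))
    (by
      intro n m h g
      ext i j
      simp only [stab, stabMatrix, Units.coe_map, MonoidHom.coe_mk, OneHom.coe_mk,
        MonoidHom.coe_coe, RingHom.mapMatrix_apply, Matrix.map_apply, Matrix.of_apply]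
      split_ifs <;> simp)
  map_one' := by
    rw [DirectLimit.one_def 0, DirectLimit.map_def, map_one, DirectLimit.one_def 0]
  map_mul' := by
    refine DirectLimit.induction₂ _ fun n g h => ?_
    rw [DirectLimit.mul_def, DirectLimit.map_def, DirectLimit.map_def, DirectLimit.map_def,
      DirectLimit.mul_def, map_mul]

/-- `K₁(R) = GL(R)^ab`, written multiplicatively. -/
abbrev K1 (R : Type*) [Ring R] : Type _ := Abelianization (StableGL R)

/-- Functoriality of `K₁`. -/
def K1.map {R S : Type*} [Ring R] [Ring S] (f : R →+* S) : K1 R →* K1 S :=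
  Abelianization.map (StableGL.map f)

/-- The class in `K₁(R)` of a unit of `R`, viewed as an invertible `1 × 1` matrix. -/
def K1.ofUnit (R : Type*) [Ring R] : Rˣ →* K1 R :=
  Abelianization.of.comp ((StableGL.of R 1).comp
    (Units.map (Matrix.scalar (Fin 1) : R →+* Matrix (Fin 1) (Fin 1) R)))

end K1

/-! ### Universal localization at a set of square matrices -/

section Localization

variable {B : Type*} [Ring B]

/-- The symbols `σ'_{ij}` adjoined as the entries of the formal inverse of each matrix `σ ∈ Σ`. -/
structure InvSymbol (Sig : ∀ n : ℕ, Set (Matrix (Fin n) (Fin n) B)) where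
  size : ℕ
  mat : Matrix (Fin size) (Fin size) B
  mem : mat ∈ Sig size
  row : Fin size
  col : Fin size

/-- The defining relations of `Σ⁻¹B`: those of the ring `B`, together with
`σ σ' = 1` and `σ' σ = 1` for every `σ ∈ Σ`. -/
inductive LocRel (Sig : ∀ n : ℕ, Set (Matrix (Fin n) (Fin n) B)) :
    FreeAlgebra ℤ (B ⊕ InvSymbol Sig) → FreeAlgebra ℤ (B ⊕ InvSymbol Sig) → Prop
  | one : LocRel Sig (FreeAlgebra.ι ℤ (Sum.inl 1)) 1
  | add (a b : B) : LocRel Sig (FreeAlgebra.ι ℤ (Sum.inl (a + b)))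
      (FreeAlgebra.ι ℤ (Sum.inl a) + FreeAlgebra.ι ℤ (Sum.inl b))
  | mul (a b : B) : LocRel Sig (FreeAlgebra.ι ℤ (Sum.inl (a * b)))
      (FreeAlgebra.ι ℤ (Sum.inl a) * FreeAlgebra.ι ℤ (Sum.inl b))
  | mul_inv (n : ℕ) (σ : Matrix (Fin n) (Fin n) B) (h : σ ∈ Sig n) (i j : Fin n) :
      LocRel Sig
        (∑ k, FreeAlgebra.ι ℤ (Sum.inl (σ i k)) * FreeAlgebra.ι ℤ (Sum.inr ⟨n, σ, h, k, j⟩))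
        (if i = j then 1 else 0)
  | inv_mul (n : ℕ) (σ : Matrix (Fin n) (Fin n) B) (h : σ ∈ Sig n) (i j : Fin n) :
      LocRel Sig
        (∑ k, FreeAlgebra.ι ℤ (Sum.inr ⟨n, σ, h, i, k⟩) * FreeAlgebra.ι ℤ (Sum.inl (σ k j)))
        (if i = j then 1 else 0)

/-- The universal localization `Σ⁻¹B`. -/
def UniversalLocalization (Sig : ∀ n : ℕ, Set (Matrix (Fin n) (Fin n) B)) : Type _ :=
  RingQuot (LocRel Sig)

instance (Sig : ∀ n : ℕ, Set (Matrix (Fin n) (Fin n) B)) : Ring (UniversalLocalization Sig) :=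
  inferInstanceAs (Ring (RingQuot (LocRel Sig)))

namespace UniversalLocalization

variable (Sig : ∀ n : ℕ, Set (Matrix (Fin n) (Fin n) B))

/-- The quotient map from the free ring. -/
def mk : FreeAlgebra ℤ (B ⊕ InvSymbol Sig) →+* UniversalLocalization Sig :=
  RingQuot.mkRingHom (LocRel Sig)

theorem mk_rel {x y : FreeAlgebra ℤ (B ⊕ InvSymbol Sig)} (h : LocRel Sig x y) :
    mk Sig x = mk Sig y :=
  RingQuot.mkRingHom_rel h

/-- The canonical map `i_Σ : B → Σ⁻¹B`. -/
def of : B →+* UniversalLocalization Sig :=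
  RingHom.mk'
    { toFun := fun b => mk Sig (FreeAlgebra.ι ℤ (Sum.inl b))
      map_one' := by rw [mk_rel Sig LocRel.one, map_one]
      map_mul' := fun a b => by rw [mk_rel Sig (LocRel.mul a b), map_mul] }
    (fun a b => by
      change mk Sig _ = mk Sig _ + mk Sig _
      rw [mk_rel Sig (LocRel.add a b), map_add])

variable {Sig}

/-- The formal inverse of `σ ∈ Σ`. -/
def invMatrix {n : ℕ} (σ : Matrix (Fin n) (Fin n) B) (h : σ ∈ Sig n) :
    Matrix (Fin n) (Fin n) (UniversalLocalization Sig) :=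
  Matrix.of fun i j => mk Sig (FreeAlgebra.ι ℤ (Sum.inr ⟨n, σ, h, i, j⟩))

theorem mul_invMatrix {n : ℕ} (σ : Matrix (Fin n) (Fin n) B) (h : σ ∈ Sig n) :
    (of Sig).mapMatrix σ * invMatrix σ h = 1 := by
  ext i j
  have := mk_rel Sig (LocRel.mul_inv n σ h i j)
  rw [map_sum] at this
  simp only [map_mul] at this
  rw [Matrix.mul_apply, Matrix.one_apply]
  refine Eq.trans this ?_
  split_ifs <;> simp

theorem invMatrix_mul {n : ℕ} (σ : Matrix (Fin n) (Fin n) B) (h : σ ∈ Sig n) :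
    invMatrix σ h * (of Sig).mapMatrix σ = 1 := by
  ext i j
  have := mk_rel Sig (LocRel.inv_mul n σ h i j)
  rw [map_sum] at this
  simp only [map_mul] at this
  rw [Matrix.mul_apply, Matrix.one_apply]
  refine Eq.trans this ?_
  split_ifs <;> simp

/-- Every matrix in `Σ` becomes invertible over `Σ⁻¹B`. -/
theorem isUnit_of {n : ℕ} (σ : Matrix (Fin n) (Fin n) B) (h : σ ∈ Sig n) :
    IsUnit ((of Sig).mapMatrix σ) :=
  ⟨⟨_, invMatrix σ h, mul_invMatrix σ h, invMatrix_mul σ h⟩, rfl⟩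

variable {T : Type*} [Ring T] (g : B →+* T) (hg : ∀ n, ∀ σ ∈ Sig n, IsUnit (g.mapMatrix σ))

/-- Auxiliary map out of the free ring. -/
def preLift : FreeAlgebra ℤ (B ⊕ InvSymbol Sig) →+* T :=
  (FreeAlgebra.lift ℤ (Sum.elim (fun b => g b)
    (fun s => (↑(hg s.size s.mat s.mem).unit⁻¹ : Matrix (Fin s.size) (Fin s.size) T)
      s.row s.col))).toRingHom

theorem preLift_inl (b : B) : preLift g hg (FreeAlgebra.ι ℤ (Sum.inl b)) = g b := by
  simp [preLift]

theorem preLift_inr (s : InvSymbol Sig) : preLift g hg (FreeAlgebra.ι ℤ (Sum.inr s)) =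
    (↑(hg s.size s.mat s.mem).unit⁻¹ : Matrix (Fin s.size) (Fin s.size) T) s.row s.col := by
  simp [preLift]

theorem preLift_rel ⦃x y : FreeAlgebra ℤ (B ⊕ InvSymbol Sig)⦄ (h : LocRel Sig x y) :
    preLift g hg x = preLift g hg y := by
  cases h with
  | one => rw [preLift_inl, map_one, map_one]
  | add a b => simp only [preLift_inl, map_add]
  | mul a b => simp only [preLift_inl, map_mul]
  | mul_inv n σ h i j =>
    have key := congrFun (congrFun (hg n σ h).mul_val_inv i) j
    rw [Matrix.mul_apply, Matrix.one_apply] at key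
    simp only [map_sum, map_mul, preLift_inl, preLift_inr]
    refine Eq.trans key ?_
    split_ifs <;> simp
  | inv_mul n σ h i j =>
    have key := congrFun (congrFun (hg n σ h).val_inv_mul i) j
    rw [Matrix.mul_apply, Matrix.one_apply] at key
    simp only [map_sum, map_mul, preLift_inl, preLift_inr]
    refine Eq.trans key ?_
    split_ifs <;> simp

/-- A `Σ`-inverting homomorphism `B → T` factors through `Σ⁻¹B`. -/
def lift : UniversalLocalization Sig →+* T :=
  RingQuot.lift ⟨preLift g hg, preLift_rel g hg⟩

theorem lift_of (b : B) : lift g hg (of Sig b) = g b :=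
  (RingQuot.lift_mkRingHom_apply _ (preLift_rel g hg) _).trans (preLift_inl g hg b)

/-- `i_Σ` is an epimorphism, so the factorization is unique. -/
theorem hom_ext {p q : UniversalLocalization Sig →+* T}
    (h : p.comp (of Sig) = q.comp (of Sig)) : p = q := by
  have hB : ∀ b, p (of Sig b) = q (of Sig b) := fun b => RingHom.congr_fun h b
  have hI : ∀ s : InvSymbol Sig, p (mk Sig (FreeAlgebra.ι ℤ (Sum.inr s))) =
      q (mk Sig (FreeAlgebra.ι ℤ (Sum.inr s))) := by
    rintro ⟨n, σ, hσ, i, j⟩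
    have h₁ : p.mapMatrix (invMatrix σ hσ) * p.mapMatrix ((of Sig).mapMatrix σ) = 1 := by
      rw [← map_mul, invMatrix_mul, map_one]
    have h₂ : q.mapMatrix ((of Sig).mapMatrix σ) * q.mapMatrix (invMatrix σ hσ) = 1 := by
      rw [← map_mul, mul_invMatrix, map_one]
    have h₃ : p.mapMatrix ((of Sig).mapMatrix σ) = q.mapMatrix ((of Sig).mapMatrix σ) := by
      ext a b
      exact hB _
    rw [h₃] at h₁
    have h₄ := left_inv_eq_right_inv h₁ h₂
    exact congrFun (congrFun h₄ i) j
  refine RingQuot.ringQuot_ext p q ?_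
  have key : ((p.comp (mk Sig)).toIntAlgHom) = ((q.comp (mk Sig)).toIntAlgHom) := by
    refine FreeAlgebra.hom_ext (funext fun x => ?_)
    rcases x with b | s
    · exact hB b
    · exact hI s
  exact RingHom.ext fun x => DFunLike.congr_fun key x

end UniversalLocalization

end Localization

/-! ### The fibre `ε⁻¹(1)` and the subgroup `C` -/

section Fibre

variable {R S : Type*} [Ring R] [Ring S]

/-- `ε⁻¹(1)` as a multiplicative group: the units of `R` sent to `1`. -/
abbrev oneFibre (ε : R →+* S) : Subgroup Rˣ := (Units.map (ε : R →* S)).ker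

/-- The elements `(1 + ab)(1 + ba)⁻¹` of `ε⁻¹(1)` with `ε(ab) = ε(ba) = 0`. -/
def commSet (ε : R →+* S) : Set (oneFibre ε) :=
  {g | ∃ (a b : R) (u v : Rˣ), ε (a * b) = 0 ∧ ε (b * a) = 0 ∧
    (u : R) = 1 + a * b ∧ (v : R) = 1 + b * a ∧ (g : Rˣ) = u * v⁻¹}

/-- The subgroup `C` of `ε⁻¹(1)`. -/
def commC (ε : R →+* S) : Subgroup (oneFibre ε) := Subgroup.closure (commSet ε)

theorem conj_mem_commSet (ε : R →+* S) (g : oneFibre ε) (hg : g ∈ commSet ε) (h : oneFibre ε) :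
    h * g * h⁻¹ ∈ commSet ε := by
  obtain ⟨a, b, u, v, hab, hba, hu, hv, hguv⟩ := hg
  set w : Rˣ := (h : Rˣ) with hw
  have e₁ : (w * a * ↑w⁻¹ : R) * (w * b * ↑w⁻¹) = w * (a * b) * ↑w⁻¹ := by
    simp only [mul_assoc, Units.inv_mul_cancel_left]
  have e₂ : (w * b * ↑w⁻¹ : R) * (w * a * ↑w⁻¹) = w * (b * a) * ↑w⁻¹ := by
    simp only [mul_assoc, Units.inv_mul_cancel_left]
  refine ⟨w * a * ↑w⁻¹, w * b * ↑w⁻¹, w * u * w⁻¹, w * v * w⁻¹, ?_, ?_, ?_, ?_, ?_⟩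
  · rw [e₁, map_mul, map_mul, hab, mul_zero, zero_mul]
  · rw [e₂, map_mul, map_mul, hba, mul_zero, zero_mul]
  · rw [e₁, Units.val_mul, Units.val_mul, hu, mul_add, add_mul, mul_one, Units.mul_inv]
  · rw [e₂, Units.val_mul, Units.val_mul, hv, mul_add, add_mul, mul_one, Units.mul_inv]
  · rw [Subgroup.coe_mul, Subgroup.coe_mul, Subgroup.coe_inv, hguv, ← hw]
    group

instance commC_normal (ε : R →+* S) : (commC ε).Normal := by
  refine ⟨fun n hn h => ?_⟩
  have hle : commC ε ≤ (commC ε).comap (MulAut.conj h).toMonoidHom := by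
    refine (Subgroup.closure_le _).2 fun g hg => ?_
    exact Subgroup.subset_closure (conj_mem_commSet ε g hg h)
  exact hle hn

end Fibre

/-! ### The augmentation localization of a group ring -/

section GroupRing

variable (A : Type*) [Ring A] (π : Type*) [Group π]

/-- The augmentation `ε : Aπ → A`, with `ε(a) = a` for `a ∈ A` and `ε(g) = 1` for `g ∈ π`. -/
def augmentation : MonoidAlgebra A π →+* A :=
  MonoidAlgebra.liftNCRingHom (RingHom.id A) (1 : π →* A) fun a _ => Commute.one_right a

theorem augmentation_single (g : π) (a : A) :
    augmentation A π (MonoidAlgebra.single g a) = a := by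
  simp [augmentation, MonoidAlgebra.liftNCRingHom]

/-- `Σ`: the square matrices over `Aπ` whose image under `ε` is invertible over `A`. -/
def augSigma (n : ℕ) : Set (Matrix (Fin n) (Fin n) (MonoidAlgebra A π)) :=
  {σ | IsUnit ((augmentation A π).mapMatrix σ)}

/-- The ring `Σ⁻¹Aπ`. -/
abbrev AugLoc : Type _ := UniversalLocalization (augSigma A π)

/-- The homomorphism `ε_Σ : Σ⁻¹Aπ → A` through which `ε` factors. -/
def augLoc : AugLoc A π →+* A :=
  UniversalLocalization.lift (augmentation A π) fun _ _ h => h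

theorem augLoc_of (x : MonoidAlgebra A π) :
    augLoc A π (UniversalLocalization.of (augSigma A π) x) = augmentation A π x :=
  UniversalLocalization.lift_of _ _ x

/-- The canonical map `A → Aπ → Σ⁻¹Aπ`. -/
def coeffMap : A →+* AugLoc A π :=
  (UniversalLocalization.of (augSigma A π)).comp MonoidAlgebra.singleOneRingHom

end GroupRing

end

end GroupRingK1

namespace GroupRingK1

/-! ### Cramer's rule in the universal localization -/

section Cramer

variable {B : Type*} [Ring B] {S : Type*} [Ring S]

theorem isUnit_fromBlocks_lower {m n : Type*} [Fintype m] [Fintype n] [DecidableEq m]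
    [DecidableEq n] {a : Matrix m m S} {d : Matrix n n S} (c : Matrix n m S)
    (ha : IsUnit a) (hd : IsUnit d) : IsUnit (Matrix.fromBlocks a 0 c d) := by
  obtain ⟨a, rfl⟩ := ha
  obtain ⟨d, rfl⟩ := hd
  refine ⟨⟨Matrix.fromBlocks ↑a 0 c ↑d, Matrix.fromBlocks ↑a⁻¹ 0
    (-((↑d⁻¹ : Matrix n n S) * c * (↑a⁻¹ : Matrix m m S))) ↑d⁻¹, ?_, ?_⟩, rfl⟩ <;>
  · simp only [Matrix.fromBlocks_multiply, ← Matrix.fromBlocks_one]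
    congr 1 <;> simp [Matrix.mul_assoc, ← Matrix.mul_assoc (d : Matrix n n S)]

theorem isUnit_fromBlocks_upper {m n : Type*} [Fintype m] [Fintype n] [DecidableEq m]
    [DecidableEq n] {a : Matrix m m S} {d : Matrix n n S} (b : Matrix m n S)
    (ha : IsUnit a) (hd : IsUnit d) : IsUnit (Matrix.fromBlocks a b 0 d) := by
  obtain ⟨a, rfl⟩ := ha
  obtain ⟨d, rfl⟩ := hd
  refine ⟨⟨Matrix.fromBlocks ↑a b 0 ↑d, Matrix.fromBlocks ↑a⁻¹
    (-((↑a⁻¹ : Matrix m m S) * b * (↑d⁻¹ : Matrix n n S))) 0 ↑d⁻¹, ?_, ?_⟩, rfl⟩ <;>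
  · simp only [Matrix.fromBlocks_multiply, ← Matrix.fromBlocks_one]
    congr 1 <;> simp [Matrix.mul_assoc, ← Matrix.mul_assoc (a : Matrix m m S)]

/-- The matrices over `B` that a ring homomorphism makes invertible. -/
def invertedBy (ε : B →+* S) (n : ℕ) : Set (Matrix (Fin n) (Fin n) B) :=
  {σ | IsUnit (ε.mapMatrix σ)}

theorem isUnit_mapMatrix_reindex {ι κ : Type*} [Fintype ι] [DecidableEq ι] [Fintype κ]
    [DecidableEq κ] (f : B →+* S) (e : ι ≃ κ) (σ : Matrix ι ι B) :
    IsUnit (f.mapMatrix (Matrix.reindex e e σ)) ↔ IsUnit (f.mapMatrix σ) := by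
  have : f.mapMatrix (Matrix.reindex e e σ) = Matrix.reindexRingEquiv S e (f.mapMatrix σ) := by
    ext; simp
  rw [this]
  exact MulEquiv.isUnit_map _

theorem isUnit_of_isUnit_map (ε : B →+* S) {ι : Type*} [Fintype ι] [DecidableEq ι]
    (σ : Matrix ι ι B) (h : IsUnit (ε.mapMatrix σ)) :
    IsUnit ((UniversalLocalization.of (invertedBy ε)).mapMatrix σ) := by
  have e := Fintype.equivFin ι
  rw [← isUnit_mapMatrix_reindex _ e]
  exact UniversalLocalization.isUnit_of _ ((isUnit_mapMatrix_reindex _ e _).2 h)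

/-- `x` is a coordinate combination of the solution of a linear system over `B` whose matrix is
inverted by `ε`. -/
def IsCramer {R : Type*} [Ring R] (i : B →+* R) (ε : B →+* S) (x : R) : Prop :=
  ∃ (ι : Type) (_ : Fintype ι) (_ : DecidableEq ι) (σ : Matrix ι ι B) (b : Matrix ι Unit B)
    (c : Matrix Unit ι B) (v : Matrix ι Unit R),
    IsUnit (ε.mapMatrix σ) ∧ σ.map i * v = b.map i ∧
    (Matrix.of fun _ _ => x : Matrix Unit Unit R) = c.map i * v

variable {R : Type*} [Ring R] (i : B →+* R) (ε : B →+* S)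

theorem IsCramer.of_map (b : B) : IsCramer i ε (i b) := by
  refine ⟨Unit, inferInstance, inferInstance, 1, Matrix.of fun _ _ => b, 1,
    Matrix.of fun _ _ => i b, by simp, ?_, ?_⟩ <;>
  · ext; simp

theorem IsCramer.of_inverse {n : ℕ} (σ : Matrix (Fin n) (Fin n) B) (h : IsUnit (ε.mapMatrix σ))
    {τ : Matrix (Fin n) (Fin n) R} (hτ : i.mapMatrix σ * τ = 1)
    (j k : Fin n) : IsCramer i ε (τ j k) := by
  refine ⟨Fin n, inferInstance, inferInstance, σ, Matrix.of fun l _ => (1 : Matrix _ _ B) l k,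
    Matrix.of fun _ l => (1 : Matrix _ _ B) j l, Matrix.of fun l _ => τ l k, h, ?_, ?_⟩
  · ext l m
    have := congrFun (congrFun hτ l) k
    simp only [Matrix.mul_apply, Matrix.map_apply, Matrix.of_apply, RingHom.mapMatrix_apply]
      at this ⊢
    rw [this, Matrix.one_apply, Matrix.one_apply]
    split_ifs <;> simp
  · ext
    simp [Matrix.mul_apply, Matrix.one_apply, apply_ite i]

variable {i ε}

theorem IsCramer.add {x y : R} (hx : IsCramer i ε x) (hy : IsCramer i ε y) :
    IsCramer i ε (x + y) := by
  obtain ⟨ι, _, _, σ, b, c, v, hσ, hv, hx⟩ := hx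
  obtain ⟨κ, _, _, τ, d, e, w, hτ, hw, hy⟩ := hy
  refine ⟨ι ⊕ κ, inferInstance, inferInstance, Matrix.fromBlocks σ 0 0 τ, Matrix.fromRows b d,
    Matrix.fromCols c e, Matrix.fromRows v w, ?_, ?_, ?_⟩
  · rw [RingHom.mapMatrix_apply, Matrix.fromBlocks_map, Matrix.map_zero _ (map_zero ε)]
    exact isUnit_fromBlocks_lower _ hσ hτ
  · rw [Matrix.fromBlocks_map, Matrix.fromBlocks_mul_fromRows]
    ext j k
    cases j <;> simp [hv, hw]
  · have : (Matrix.fromCols c e).map i = Matrix.fromCols (c.map i) (e.map i) := by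
      ext j (k | k) <;> rfl
    rw [this, Matrix.fromCols_mul_fromRows, ← hx, ← hy]
    rfl

/-- Stack the systems as `[[σ, -be], [0, τ]] (vy; w) = (0; d)`: since `y = ew`, the first row says
`σvy = bew = by`, and `c` applied to `vy` gives `xy`. -/
theorem IsCramer.mul {x y : R} (hx : IsCramer i ε x) (hy : IsCramer i ε y) :
    IsCramer i ε (x * y) := by
  obtain ⟨ι, _, _, σ, b, c, v, hσ, hv, hx⟩ := hx
  obtain ⟨κ, _, _, τ, d, e, w, hτ, hw, hy⟩ := hy
  refine ⟨ι ⊕ κ, inferInstance, inferInstance, Matrix.fromBlocks σ (-(b * e)) 0 τ,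
    Matrix.fromRows 0 d, Matrix.fromCols c 0,
    Matrix.fromRows (v * (Matrix.of fun _ _ => y : Matrix Unit Unit R)) w, ?_, ?_, ?_⟩
  · rw [RingHom.mapMatrix_apply, Matrix.fromBlocks_map, Matrix.map_zero _ (map_zero ε)]
    exact isUnit_fromBlocks_upper _ hσ hτ
  · rw [Matrix.fromBlocks_map, Matrix.fromBlocks_mul_fromRows, ← Matrix.mul_assoc, hv, hy,
      Matrix.map_neg _ (map_neg _), Matrix.map_mul]
    ext j k
    cases j <;> simp [hw, Matrix.mul_assoc]
  · have : (Matrix.fromCols c (0 : Matrix Unit κ B)).map i = Matrix.fromCols (c.map i) 0 := by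
      ext j (k | k) <;> simp
    rw [this, Matrix.fromCols_mul_fromRows, ← Matrix.mul_assoc, ← hx]
    ext
    simp [Matrix.mul_apply]

/-- The identity corner forces the lower left block of the inverse to vanish, so its lower right
block is a two-sided inverse of `d`. Without this corner the conclusion can fail over a
noncommutative ring. -/
theorem isUnit_of_isUnit_fromBlocks {m n : Type*} [Fintype m] [Fintype n] [DecidableEq m]
    [DecidableEq n] {b : Matrix m n S} {d : Matrix n n S}
    (h : IsUnit (Matrix.fromBlocks (1 : Matrix m m S) b 0 d)) : IsUnit d := by
  obtain ⟨u, hu⟩ := h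
  have h₁ := u.mul_inv
  have h₂ := u.inv_mul
  rw [hu, ← Matrix.fromBlocks_toBlocks (↑u⁻¹ : Matrix (m ⊕ n) (m ⊕ n) S),
    Matrix.fromBlocks_multiply, ← Matrix.fromBlocks_one, Matrix.fromBlocks_inj] at h₁ h₂
  simp only [Matrix.mul_one, Matrix.mul_zero, add_zero] at h₂
  obtain ⟨-, -, -, h₁⟩ := h₁
  obtain ⟨-, -, h₂, h₃⟩ := h₂
  rw [h₂] at h₃
  exact ⟨⟨d, _, by simpa using h₁, by simpa using h₃⟩, rfl⟩

theorem IsCramer.isUnit {p : R →+* S} (hp : ∀ b, p (i b) = ε b)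
    (hi : ∀ {ι : Type} [Fintype ι] [DecidableEq ι] (σ : Matrix ι ι B),
      IsUnit (ε.mapMatrix σ) → IsUnit (i.mapMatrix σ))
    {x : R} (h : IsCramer i ε x) (hx : IsUnit (p x)) : IsUnit x := by
  obtain ⟨ι, _, _, σ, b, c, v, hσ, hv, hx'⟩ := h
  have hpi : ∀ {m n : Type} (M : Matrix m n B), (M.map i).map p = M.map ε := fun M => by
    ext; simp [hp]
  set X : Matrix Unit Unit R := Matrix.of fun _ _ => x
  -- The bordered matrix has entries in `B`, yet over `R` it factors as `[[σ, 0], [c, 1]] * [[1,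
  -- -v], [0, x]]`, because `σv = b` and `cv = x`.
  set T : Matrix (ι ⊕ Unit) (ι ⊕ Unit) B := Matrix.fromBlocks σ (-b) c 0 with hTdef
  have hT : i.mapMatrix T = Matrix.fromBlocks (σ.map i) 0 (c.map i) 1 *
      Matrix.fromBlocks 1 (-v) 0 X := by
    rw [Matrix.fromBlocks_multiply, RingHom.mapMatrix_apply, hTdef, Matrix.fromBlocks_map,
      Matrix.map_neg _ (map_neg i), Matrix.map_zero _ (map_zero i)]
    congr 1 <;> simp [hv, hx']
  have hεT : ε.mapMatrix T = Matrix.fromBlocks (σ.map ε) 0 (c.map ε) 1 *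
      Matrix.fromBlocks 1 (-(v.map p)) 0 (X.map p) := by
    have := congrArg p.mapMatrix hT
    rw [map_mul] at this
    simp only [RingHom.mapMatrix_apply, hTdef, Matrix.fromBlocks_map, hpi] at this
    simpa [Matrix.map_neg _ (map_neg p), hTdef, Matrix.fromBlocks_map] using this
  have hX : IsUnit (X.map p) := by
    obtain ⟨u, hu⟩ := hx
    refine ⟨⟨_, Matrix.of fun _ _ => ↑u⁻¹, ?_, ?_⟩, rfl⟩ <;>
    · ext
      simp [X, Matrix.mul_apply, ← hu]
  -- Invertibility passes from `p x` to `ε(T)`, then to `T` over `R` by `hi`, and finally to `x` by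
  -- cancelling the left factor.
  have h₁ : IsUnit (i.mapMatrix T) := by
    refine hi _ ?_
    rw [hεT]
    exact (isUnit_fromBlocks_lower _ hσ isUnit_one).mul (isUnit_fromBlocks_upper _ isUnit_one hX)
  rw [hT] at h₁
  have h₂ : IsUnit (Matrix.fromBlocks (σ.map i) 0 (c.map i) (1 : Matrix Unit Unit R)) :=
    isUnit_fromBlocks_lower _ (hi σ hσ) isUnit_one
  obtain ⟨u, hu⟩ := h₂
  rw [← hu, Units.isUnit_units_mul] at h₁
  obtain ⟨w, hw⟩ := isUnit_of_isUnit_fromBlocks h₁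
  refine ⟨⟨x, (↑w⁻¹ : Matrix Unit Unit R) () (), ?_, ?_⟩, rfl⟩
  · simpa [Matrix.mul_apply, hw, X] using congrFun (congrFun w.mul_inv ()) ()
  · simpa [Matrix.mul_apply, hw, X] using congrFun (congrFun w.inv_mul ()) ()

theorem isCramer_universalLocalization (ε : B →+* S) (x : UniversalLocalization (invertedBy ε)) :
    IsCramer (UniversalLocalization.of (invertedBy ε)) ε x := by
  obtain ⟨x, rfl⟩ : ∃ y, UniversalLocalization.mk (invertedBy ε) y = x :=
    RingQuot.mkRingHom_surjective _ x
  induction x using FreeAlgebra.induction with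
  | grade0 r =>
    have := IsCramer.of_map (UniversalLocalization.of (invertedBy ε)) ε (r : B)
    simpa using this
  | grade1 x =>
    obtain b | ⟨n, σ, h, i, j⟩ := x
    · exact IsCramer.of_map _ ε b
    · exact IsCramer.of_inverse _ ε σ h (UniversalLocalization.mul_invMatrix σ h) i j
  | mul a b ha hb => rw [map_mul]; exact ha.mul hb
  | add a b ha hb => rw [map_add]; exact ha.add hb

/-- `augSigma A π` unfolds to `invertedBy (augmentation A π)`, so the general criterion applies. -/
theorem isUnit_of_isUnit_augLoc (A : Type*) [Ring A] (π : Type*) [Group π] {x : AugLoc A π}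
    (hx : IsUnit (augLoc A π x)) : IsUnit x :=
  (isCramer_universalLocalization (augmentation A π) x).isUnit (augLoc_of A π)
    (isUnit_of_isUnit_map (augmentation A π)) hx

end Cramer

noncomputable section

/-! ### The Dieudonné determinant on matrices congruent to the identity -/

section Det

variable {R S : Type*} [Ring R] [Ring S] {ε : R →+* S} {Q : Type*} [CommGroup Q]

/-- Extension by `1` of a homomorphism on `ε⁻¹(1)` to a function on the whole ring. -/
def unitDet (ψ : oneFibre ε →* Q) (x : R) : Q :=
  open Classical in if h : ∃ u : oneFibre ε, ((u : Rˣ) : R) = x then ψ h.choose else 1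

theorem unitDet_coe (ψ : oneFibre ε →* Q) (u : oneFibre ε) :
    unitDet ψ ((u : Rˣ) : R) = ψ u := by
  have h : ∃ w : oneFibre ε, ((w : Rˣ) : R) = (u : Rˣ) := ⟨u, rfl⟩
  rw [unitDet, dif_pos h]
  congr 1
  exact Subtype.ext (Units.ext h.choose_spec)

theorem exists_oneFibre (hε : ∀ x, ε x = 1 → IsUnit x) {x : R} (hx : ε x = 1) :
    ∃ u : oneFibre ε, ((u : Rˣ) : R) = x := by
  obtain ⟨u, rfl⟩ := hε x hx
  exact ⟨⟨u, Units.ext hx⟩, rfl⟩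

theorem map_oneFibre (u : oneFibre ε) : ε ((u : Rˣ) : R) = 1 :=
  congrArg Units.val u.2

theorem unitDet_mul (hε : ∀ x, ε x = 1 → IsUnit x) (ψ : oneFibre ε →* Q) {x y : R}
    (hx : ε x = 1) (hy : ε y = 1) : unitDet ψ (x * y) = unitDet ψ x * unitDet ψ y := by
  obtain ⟨u, rfl⟩ := exists_oneFibre hε hx
  obtain ⟨v, rfl⟩ := exists_oneFibre hε hy
  have := unitDet_coe ψ (u * v)
  rw [Subgroup.coe_mul, Units.val_mul] at this
  rw [this, unitDet_coe, unitDet_coe, map_mul]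

theorem unitDet_one_add_mul_comm (hε : ∀ x, ε x = 1 → IsUnit x) {ψ : oneFibre ε →* Q}
    (hψ : ∀ g ∈ commSet ε, ψ g = 1) {x y : R} (hxy : ε (x * y) = 0) (hyx : ε (y * x) = 0) :
    unitDet ψ (1 + x * y) = unitDet ψ (1 + y * x) := by
  obtain ⟨u, hu⟩ := exists_oneFibre hε (x := 1 + x * y) (by rw [map_add, hxy, map_one, add_zero])
  obtain ⟨v, hv⟩ := exists_oneFibre hε (x := 1 + y * x) (by rw [map_add, hyx, map_one, add_zero])
  rw [← hu, ← hv, unitDet_coe, unitDet_coe, ← mul_inv_eq_one, ← map_inv, ← map_mul]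
  exact hψ _ ⟨x, y, u, v, hxy, hyx, hu, hv, rfl⟩

/-- The Dieudonné determinant of a matrix congruent to `1`, computed by pivoting on the last
diagonal entry. -/
def dieudonne (ψ : oneFibre ε →* Q) : (n : ℕ) → Matrix (Fin n) (Fin n) R → Q
  | 0, _ => 1
  | n + 1, M =>
    let N : Matrix (Fin n ⊕ Fin 1) (Fin n ⊕ Fin 1) R := M.submatrix finSumFinEquiv finSumFinEquiv
    dieudonne ψ n (N.toBlocks₁₁ - N.toBlocks₁₂ * Ring.inverse N.toBlocks₂₂ * N.toBlocks₂₁) *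
      unitDet ψ (N.toBlocks₂₂ 0 0)

theorem dieudonne_one (ψ : oneFibre ε →* Q) (M : Matrix (Fin 1) (Fin 1) R) :
    dieudonne ψ 1 M = unitDet ψ (M 0 0) := by
  simp only [dieudonne, one_mul]
  rfl

/-- The matrix `[[1, x], [0, 1]] * [[s, 0], [0, d]] * [[1, 0], [y, 1]]`. -/
def gaussMatrix {m n : Type*} [Fintype n] (x : Matrix m n R) (s : Matrix m m R)
    (d : Matrix n n R) (y : Matrix n m R) : Matrix (m ⊕ n) (m ⊕ n) R :=
  Matrix.fromBlocks (s + x * d * y) (x * d) (d * y) d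

/-- The Schur complement of `d` in the Gauss product is exactly `s`. All later computations use this
factored form and never unfold the recursion. -/
theorem dieudonne_gaussMatrix (ψ : oneFibre ε →* Q) {n : ℕ} (x : Matrix (Fin n) (Fin 1) R)
    (s : Matrix (Fin n) (Fin n) R) {d : Matrix (Fin 1) (Fin 1) R} (hd : IsUnit d)
    (y : Matrix (Fin 1) (Fin n) R) :
    dieudonne ψ (n + 1) (Matrix.reindex finSumFinEquiv finSumFinEquiv (gaussMatrix x s d y)) =
      dieudonne ψ n s * dieudonne ψ 1 d := by
  rw [dieudonne_one, dieudonne]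
  simp only [Matrix.reindex_apply, Matrix.submatrix_submatrix, Equiv.symm_comp_self,
    Matrix.submatrix_id_id, gaussMatrix, Matrix.toBlocks_fromBlocks₁₁,
    Matrix.toBlocks_fromBlocks₁₂, Matrix.toBlocks_fromBlocks₂₁, Matrix.toBlocks_fromBlocks₂₂]
  congr 2
  rw [Matrix.mul_assoc x d (Ring.inverse d), Ring.mul_inverse_cancel _ hd, Matrix.mul_one,
    Matrix.mul_assoc, add_sub_cancel_right]

theorem exists_gaussMatrix {m n : Type*} [Fintype n] [DecidableEq n]
    (M : Matrix (m ⊕ n) (m ⊕ n) R) (hd : IsUnit M.toBlocks₂₂) :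
    ∃ x s y, M = gaussMatrix x s M.toBlocks₂₂ y := by
  obtain ⟨d, hd⟩ := hd
  refine ⟨M.toBlocks₁₂ * (↑d⁻¹ : Matrix n n R),
    M.toBlocks₁₁ - M.toBlocks₁₂ * (↑d⁻¹ : Matrix n n R) * M.toBlocks₂₁,
    (↑d⁻¹ : Matrix n n R) * M.toBlocks₂₁, ?_⟩
  conv_lhs => rw [← Matrix.fromBlocks_toBlocks M]
  rw [gaussMatrix, ← hd]
  congr 1
  · simp [Matrix.mul_assoc]
  · simp [Matrix.mul_assoc]
  · simp [← Matrix.mul_assoc (d : Matrix n n R)]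

theorem units_mul_inv_mul {n k : Type*} [Fintype n] [DecidableEq n] (d : (Matrix n n R)ˣ)
    (z : Matrix n k R) : (d : Matrix n n R) * ((↑d⁻¹ : Matrix n n R) * z) = z := by
  rw [← Matrix.mul_assoc, Units.mul_inv, Matrix.one_mul]

theorem units_inv_mul_mul {n k : Type*} [Fintype n] [DecidableEq n] (d : (Matrix n n R)ˣ)
    (z : Matrix n k R) : (↑d⁻¹ : Matrix n n R) * ((d : Matrix n n R) * z) = z := by
  rw [← Matrix.mul_assoc, Units.inv_mul, Matrix.one_mul]

/-- Only the inner product `[[1, 0], [y, 1]] * [[1, x'], [0, 1]]` is out of order. Refactoring it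
with pivot `e = 1 + yx'` gives Schur complement `1 - x'e⁻¹y`; the diagonal factors are then moved
past the unipotent ones. -/
theorem gaussMatrix_mul {m n : Type*} [Fintype m] [Fintype n] [DecidableEq m] [DecidableEq n]
    (x x' : Matrix m n R) (s s' : Matrix m m R) (d d' e : (Matrix n n R)ˣ) (y y' : Matrix n m R)
    (he : (e : Matrix n n R) = 1 + y * x') :
    gaussMatrix x s d y * gaussMatrix x' s' d' y' =
      gaussMatrix (x + s * x' * (↑e⁻¹ : Matrix n n R) * (↑d⁻¹ : Matrix n n R))
        (s * (1 - x' * (↑e⁻¹ : Matrix n n R) * y) * s') ↑(d * e * d')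
        (y' + (↑d'⁻¹ : Matrix n n R) * (↑e⁻¹ : Matrix n n R) * y * s') := by
  have hyx : y * x' = (e : Matrix n n R) - 1 := by rw [he]; abel
  have hyx₁ (z : Matrix n n R) : y * (x' * z) = (e : Matrix n n R) * z - z := by
    rw [← Matrix.mul_assoc, hyx, Matrix.sub_mul, Matrix.one_mul]
  have hyx₂ (z : Matrix n m R) : y * (x' * z) = (e : Matrix n n R) * z - z := by
    rw [← Matrix.mul_assoc, hyx, Matrix.sub_mul, Matrix.one_mul]
  simp only [gaussMatrix, Matrix.fromBlocks_multiply]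
  congr 1 <;>
  · simp only [Units.val_mul, Matrix.mul_add, Matrix.add_mul, Matrix.mul_sub, Matrix.sub_mul,
      Matrix.mul_assoc, units_mul_inv_mul, units_inv_mul_mul, hyx₁, hyx₂, Matrix.mul_one]
    abel

theorem gaussMatrix_eq {m n : Type*} [Fintype m] [Fintype n] [DecidableEq m] [DecidableEq n]
    (x : Matrix m n R) (s : Matrix m m R) (d : Matrix n n R) (y : Matrix n m R) :
    gaussMatrix x s d y = Matrix.fromBlocks 1 x 0 1 * Matrix.fromBlocks s 0 0 d *
      Matrix.fromBlocks 1 0 y 1 := by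
  simp [Matrix.fromBlocks_multiply, gaussMatrix]

theorem exists_gaussMatrix_of_map_eq_one {m n : Type*} [Fintype n] [DecidableEq m] [DecidableEq n]
    {M : Matrix (m ⊕ n) (m ⊕ n) R} (hn : ∀ N : Matrix n n R, N.map ε = 1 → IsUnit N)
    (hM : M.map ε = 1) :
    ∃ (x : Matrix m n R) (s : Matrix m m R) (d : (Matrix n n R)ˣ) (y : Matrix n m R),
      x.map ε = 0 ∧ s.map ε = 1 ∧ (d : Matrix n n R).map ε = 1 ∧ y.map ε = 0 ∧
      M = gaussMatrix x s d y := by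
  rw [← Matrix.fromBlocks_toBlocks M, Matrix.fromBlocks_map, ← Matrix.fromBlocks_one,
    Matrix.fromBlocks_inj] at hM
  obtain ⟨h₁, h₂, h₃, h₄⟩ := hM
  obtain ⟨d, hd⟩ := hn _ h₄
  obtain ⟨x, s, y, hx⟩ := exists_gaussMatrix M ⟨d, hd⟩
  rw [hx] at h₁ h₂ h₃
  rw [← hd] at h₁ h₂ h₃ h₄
  simp only [gaussMatrix, Matrix.toBlocks_fromBlocks₁₂,
    Matrix.toBlocks_fromBlocks₂₁, Matrix.map_mul, h₄, Matrix.mul_one, Matrix.one_mul] at h₂ h₃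
  rw [gaussMatrix, Matrix.toBlocks_fromBlocks₁₁, Matrix.map_add _ (map_add ε), Matrix.map_mul, h₃,
    Matrix.mul_zero, add_zero] at h₁
  exact ⟨x, s, d, y, h₂, h₁, h₄, h₃, by rw [hd]; exact hx⟩

theorem isUnit_of_map_eq_one_fin_one (hε : ∀ x, ε x = 1 → IsUnit x) (M : Matrix (Fin 1) (Fin 1) R)
    (hM : M.map ε = 1) : IsUnit M := by
  have h : IsUnit ((Matrix.uniqueRingEquiv : Matrix (Fin 1) (Fin 1) R ≃+* R) M) := by
    refine hε _ ?_
    simpa using congrFun (congrFun hM 0) 0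
  exact (MulEquiv.isUnit_map _).1 h

theorem map_reindex_eq_one {m n : Type*} [DecidableEq m] [DecidableEq n] (e : m ≃ n)
    (M : Matrix m m R) : (Matrix.reindex e e M).map ε = 1 ↔ M.map ε = 1 := by
  rw [← (Matrix.reindex e e).injective.eq_iff (a := M.map ε), Matrix.reindex_apply,
    Matrix.reindex_apply, Matrix.reindex_apply, Matrix.submatrix_one_equiv]
  rfl

/-- Eliminate with the last diagonal entry as pivot: it is a unit by `hε`, and the Schur complement
is again congruent to `1`. -/
theorem isUnit_of_map_eq_one (hε : ∀ x, ε x = 1 → IsUnit x) {n : ℕ}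
    (M : Matrix (Fin n) (Fin n) R) (hM : M.map ε = 1) : IsUnit M := by
  induction n with
  | zero => exact ⟨1, Subsingleton.elim _ _⟩
  | succ n ih =>
    obtain ⟨M, rfl⟩ := (Matrix.reindex finSumFinEquiv finSumFinEquiv).surjective M
    rw [map_reindex_eq_one] at hM
    obtain ⟨x, s, d, y, -, hs, -, -, rfl⟩ :=
      exists_gaussMatrix_of_map_eq_one (isUnit_of_map_eq_one_fin_one hε) hM
    refine (MulEquiv.isUnit_map (Matrix.reindexRingEquiv R finSumFinEquiv)).2 ?_
    rw [gaussMatrix_eq]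
    exact ((isUnit_fromBlocks_upper _ isUnit_one isUnit_one).mul
      (isUnit_fromBlocks_upper _ (ih s hs) d.isUnit)).mul
      (isUnit_fromBlocks_lower _ isUnit_one isUnit_one)

theorem dieudonne_matrix_one (ψ : oneFibre ε →* Q) (n : ℕ) :
    dieudonne ψ n (1 : Matrix (Fin n) (Fin n) R) = 1 := by
  induction n with
  | zero => rfl
  | succ n ih =>
    have h : (1 : Matrix (Fin (n + 1)) (Fin (n + 1)) R) =
        Matrix.reindex finSumFinEquiv finSumFinEquiv (gaussMatrix 0 1 1 0) := by
      simp [gaussMatrix]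
    have h₁ : unitDet ψ (1 : R) = 1 := by simpa using unitDet_coe ψ 1
    rw [h, dieudonne_gaussMatrix _ _ _ isUnit_one, ih, dieudonne_one, Matrix.one_apply_eq, h₁,
      one_mul]

theorem dieudonne_one_mul (hε : ∀ x, ε x = 1 → IsUnit x) (ψ : oneFibre ε →* Q)
    {M N : Matrix (Fin 1) (Fin 1) R} (hM : M.map ε = 1) (hN : N.map ε = 1) :
    dieudonne ψ 1 (M * N) = dieudonne ψ 1 M * dieudonne ψ 1 N := by
  simp only [dieudonne_one, Matrix.mul_apply, Finset.univ_unique, Fin.default_eq_zero,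
    Finset.sum_singleton]
  exact unitDet_mul hε ψ (by simpa using congrFun (congrFun hM 0) 0)
    (by simpa using congrFun (congrFun hN 0) 0)

/-- Invariance of the determinant under exchanging the factors of `1 + x * y`. -/
def DieudonneSwap (ψ : oneFibre ε →* Q) (m k : ℕ) : Prop :=
  ∀ (x : Matrix (Fin m) (Fin k) R) (y : Matrix (Fin k) (Fin m) R), x.map ε = 0 ∨ y.map ε = 0 →
    dieudonne ψ m (1 + x * y) = dieudonne ψ k (1 + y * x)

theorem map_one_add_mul_eq_one {m n : Type*} [Fintype n] [DecidableEq m] {x : Matrix m n R}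
    {y : Matrix n m R} (h : x.map ε = 0 ∨ y.map ε = 0) : (1 + x * y).map ε = 1 := by
  rw [Matrix.map_add _ (map_add ε), Matrix.map_mul, Matrix.map_one _ (map_zero ε) (map_one ε)]
  rcases h with h | h <;> simp [h]

/-- Peel the last row `X₂` off `x` and the last column `Y₂` off `y`. Elimination with pivot `d = 1 +
X₂Y₂` leaves `1 + X₁z`. Swapping both pieces and multiplying in size `k` gives `(1 + Y₂X₂)(1 + zX₁)
= 1 + yx`. -/
theorem DieudonneSwap.succ (hε : ∀ x, ε x = 1 → IsUnit x) {ψ : oneFibre ε →* Q} {m k : ℕ}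
    (hk : ∀ M N : Matrix (Fin k) (Fin k) R, M.map ε = 1 → N.map ε = 1 →
      dieudonne ψ k (M * N) = dieudonne ψ k M * dieudonne ψ k N)
    (hm : DieudonneSwap ψ m k) (h₁ : DieudonneSwap ψ 1 k) : DieudonneSwap ψ (m + 1) k := by
  intro x y h
  obtain ⟨X₁, X₂, rfl⟩ : ∃ X₁ X₂, x = (Matrix.fromRows X₁ X₂).submatrix finSumFinEquiv.symm id :=
    ⟨(x.submatrix finSumFinEquiv id).toRows₁, (x.submatrix finSumFinEquiv id).toRows₂, by
      simp [Matrix.fromRows_toRows]⟩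
  obtain ⟨Y₁, Y₂, rfl⟩ : ∃ Y₁ Y₂, y = (Matrix.fromCols Y₁ Y₂).submatrix id finSumFinEquiv.symm :=
    ⟨(y.submatrix id finSumFinEquiv).toCols₁, (y.submatrix id finSumFinEquiv).toCols₂, by
      simp [Matrix.fromCols_toCols]⟩
  have hX : (X₁.map ε = 0 ∧ X₂.map ε = 0) ∨ (Y₁.map ε = 0 ∧ Y₂.map ε = 0) := by
    refine h.imp (fun h => ⟨?_, ?_⟩) (fun h => ⟨?_, ?_⟩)
    · ext i j; simpa using congrFun (congrFun h (finSumFinEquiv (Sum.inl i))) j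
    · ext i j; simpa using congrFun (congrFun h (finSumFinEquiv (Sum.inr i))) j
    · ext i j; simpa using congrFun (congrFun h i) (finSumFinEquiv (Sum.inl j))
    · ext i j; simpa using congrFun (congrFun h i) (finSumFinEquiv (Sum.inr j))
  have h₂ : X₂.map ε = 0 ∨ Y₂.map ε = 0 := hX.imp And.right And.right
  obtain ⟨d, hd⟩ := isUnit_of_map_eq_one_fin_one hε _ (map_one_add_mul_eq_one h₂)
  have hXY : X₂ * Y₂ = (d : Matrix (Fin 1) (Fin 1) R) - 1 := by rw [hd]; abel
  -- The bracket is the inverse of `1 + Y₂X₂`, expressed through the `1 × 1` inverse `d⁻¹`.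
  set z : Matrix (Fin k) (Fin m) R := (1 - Y₂ * (↑d⁻¹ : Matrix (Fin 1) (Fin 1) R) * X₂) * Y₁ with hz
  have hz' : X₁.map ε = 0 ∨ z.map ε = 0 := by
    refine hX.imp And.left fun h => ?_
    rw [hz, Matrix.map_mul, h.1, Matrix.mul_zero]
  have hz'' : z.map ε = 0 ∨ X₁.map ε = 0 := hz'.symm
  have e₁ : 1 + (Matrix.fromRows X₁ X₂).submatrix finSumFinEquiv.symm id *
      (Matrix.fromCols Y₁ Y₂).submatrix id finSumFinEquiv.symm =
      Matrix.reindex finSumFinEquiv finSumFinEquiv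
        (gaussMatrix (X₁ * Y₂ * (↑d⁻¹ : Matrix (Fin 1) (Fin 1) R)) (1 + X₁ * z) d
          ((↑d⁻¹ : Matrix (Fin 1) (Fin 1) R) * X₂ * Y₁)) := by
    have hG : 1 + Matrix.fromRows X₁ X₂ * Matrix.fromCols Y₁ Y₂ =
        gaussMatrix (X₁ * Y₂ * (↑d⁻¹ : Matrix (Fin 1) (Fin 1) R)) (1 + X₁ * z) d
          ((↑d⁻¹ : Matrix (Fin 1) (Fin 1) R) * X₂ * Y₁) := by
      rw [Matrix.fromRows_mul_fromCols, ← Matrix.fromBlocks_one, Matrix.fromBlocks_add, gaussMatrix]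
      congr 1
      · simp only [hz, Matrix.mul_sub, Matrix.sub_mul, Matrix.mul_assoc, units_inv_mul_mul,
          Matrix.one_mul]
        abel
      · rw [zero_add, Matrix.mul_assoc _ _ (d : Matrix (Fin 1) (Fin 1) R), Units.inv_mul,
          Matrix.mul_one]
      · rw [zero_add, Matrix.mul_assoc, units_mul_inv_mul]
      · exact hd.symm
    rw [← hG]
    ext i j
    simp only [Matrix.add_apply, Matrix.mul_apply, Matrix.one_apply, Matrix.reindex_apply,
      Matrix.submatrix_apply, id, EmbeddingLike.apply_eq_iff_eq]
  have e₂ : (Matrix.fromCols Y₁ Y₂).submatrix id finSumFinEquiv.symm *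
      (Matrix.fromRows X₁ X₂).submatrix finSumFinEquiv.symm id = Y₁ * X₁ + Y₂ * X₂ := by
    rw [Matrix.submatrix_mul_equiv, Matrix.fromCols_mul_fromRows, Matrix.submatrix_id_id]
  have e₃ : (1 + Y₂ * X₂) * (1 + z * X₁) = 1 + (Y₁ * X₁ + Y₂ * X₂) := by
    have hXY₁ (w : Matrix (Fin 1) (Fin k) R) :
        X₂ * (Y₂ * w) = (d : Matrix (Fin 1) (Fin 1) R) * w - w := by
      rw [← Matrix.mul_assoc, hXY, Matrix.sub_mul, Matrix.one_mul]
    simp only [hz, Matrix.mul_add, Matrix.add_mul, Matrix.mul_sub, Matrix.sub_mul,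
      Matrix.mul_assoc, units_mul_inv_mul, hXY₁, Matrix.mul_one, Matrix.one_mul]
    abel
  rw [e₁, e₂, dieudonne_gaussMatrix _ _ _ d.isUnit, hm _ _ hz', hd, h₁ _ _ h₂, ← e₃,
    hk _ _ (map_one_add_mul_eq_one h₂.symm) (map_one_add_mul_eq_one hz''), mul_comm]

theorem DieudonneSwap.zero (ψ : oneFibre ε →* Q) (k : ℕ) : DieudonneSwap ψ 0 k := by
  intro x y _
  rw [show y * x = 0 by ext; simp [Matrix.mul_apply], add_zero, dieudonne_matrix_one]
  rfl

/-- For `k = 1` the induction needs multiplicativity only of `1 × 1` determinants. This case can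
therefore precede `dieudonne_mul`, which relies on it, and no circularity arises. -/
theorem DieudonneSwap.right_one (hε : ∀ x, ε x = 1 → IsUnit x) {ψ : oneFibre ε →* Q}
    (hψ : ∀ g ∈ commSet ε, ψ g = 1) (n : ℕ) : DieudonneSwap ψ n 1 := by
  have h₁ : DieudonneSwap ψ 1 1 := by
    intro x y h
    simp only [dieudonne_one, Matrix.add_apply, Matrix.one_apply_eq, Matrix.mul_apply,
      Finset.univ_unique, Fin.default_eq_zero, Finset.sum_singleton]
    have : ε (x 0 0) = 0 ∨ ε (y 0 0) = 0 :=
      h.imp (fun h => congrFun (congrFun h 0) 0) (fun h => congrFun (congrFun h 0) 0)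
    refine unitDet_one_add_mul_comm hε hψ ?_ ?_ <;> rw [map_mul] <;>
      rcases this with h | h <;> simp [h]
  induction n with
  | zero => exact .zero ψ 1
  | succ n ih => exact ih.succ hε (fun _ _ => dieudonne_one_mul hε ψ) h₁

/-- By `gaussMatrix_mul`, the product has the extra factors `e` in its pivot and `1 - x'e⁻¹y` in its
Schur complement. Swapping turns the latter into `1 - yx'e⁻¹ = e⁻¹`, so the two contributions cancel
in `Q`. -/
theorem dieudonne_mul (hε : ∀ x, ε x = 1 → IsUnit x) {ψ : oneFibre ε →* Q}
    (hψ : ∀ g ∈ commSet ε, ψ g = 1) {n : ℕ} {M N : Matrix (Fin n) (Fin n) R}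
    (hM : M.map ε = 1) (hN : N.map ε = 1) :
    dieudonne ψ n (M * N) = dieudonne ψ n M * dieudonne ψ n N := by
  induction n with
  | zero => exact (one_mul _).symm
  | succ n ih =>
    obtain ⟨M, rfl⟩ := (Matrix.reindex finSumFinEquiv finSumFinEquiv).surjective M
    obtain ⟨N, rfl⟩ := (Matrix.reindex finSumFinEquiv finSumFinEquiv).surjective N
    rw [map_reindex_eq_one] at hM hN
    have h₁ := isUnit_of_map_eq_one_fin_one hε
    obtain ⟨x, s, d, y, hx, hs, hd, hy, rfl⟩ := exists_gaussMatrix_of_map_eq_one h₁ hM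
    obtain ⟨x', s', d', y', hx', hs', hd', hy', rfl⟩ := exists_gaussMatrix_of_map_eq_one h₁ hN
    have hyx : (1 + y * x').map ε = 1 := map_one_add_mul_eq_one (Or.inl hy)
    obtain ⟨e, he⟩ := h₁ _ hyx
    have hee : (1 : Matrix _ _ R) + y * -(x' * (↑e⁻¹ : Matrix (Fin 1) (Fin 1) R)) =
        (↑e⁻¹ : Matrix (Fin 1) (Fin 1) R) := by
      rw [Matrix.mul_neg, ← Matrix.mul_assoc, show y * x' = (e : Matrix (Fin 1) (Fin 1) R) - 1 by
        rw [he]; abel, Matrix.sub_mul, Units.mul_inv, Matrix.one_mul]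
      abel
    have he₁ : (e : Matrix (Fin 1) (Fin 1) R).map ε = 1 := he ▸ hyx
    have he₂ : (↑e⁻¹ : Matrix (Fin 1) (Fin 1) R).map ε = 1 := by
      rw [← hee]; exact map_one_add_mul_eq_one (Or.inl hy)
    have hs₁ : (1 - x' * (↑e⁻¹ : Matrix (Fin 1) (Fin 1) R) * y) =
        1 + -(x' * (↑e⁻¹ : Matrix (Fin 1) (Fin 1) R)) * y := by
      rw [Matrix.neg_mul, sub_eq_add_neg]
    have hs₂ : (1 + -(x' * (↑e⁻¹ : Matrix (Fin 1) (Fin 1) R)) * y).map ε = 1 :=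
      map_one_add_mul_eq_one (Or.inr hy)
    have hmul : ∀ {m : ℕ} {a b : Matrix (Fin m) (Fin m) R}, a.map ε = 1 → b.map ε = 1 →
        (a * b).map ε = 1 := fun ha hb => by rw [Matrix.map_mul, ha, hb, one_mul]
    rw [dieudonne_gaussMatrix _ _ _ d.isUnit, dieudonne_gaussMatrix _ _ _ d'.isUnit,
      Matrix.reindex_apply, Matrix.reindex_apply, Matrix.submatrix_mul_equiv,
      gaussMatrix_mul x x' s s' d d' e y y' he, ← Matrix.reindex_apply,
      dieudonne_gaussMatrix _ _ _ (Units.isUnit _), hs₁, ih (hmul hs hs₂) hs', ih hs hs₂,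
      DieudonneSwap.right_one hε hψ n _ _ (Or.inr hy), hee, Units.val_mul, Units.val_mul,
      dieudonne_one_mul hε ψ (hmul hd he₁) hd', dieudonne_one_mul hε ψ hd he₁]
    have hinv : dieudonne ψ 1 (↑e⁻¹ : Matrix (Fin 1) (Fin 1) R) *
        dieudonne ψ 1 (e : Matrix (Fin 1) (Fin 1) R) = 1 := by
      rw [← dieudonne_one_mul hε ψ he₂ he₁, Units.inv_mul, dieudonne_matrix_one]
    rw [eq_inv_of_mul_eq_one_left hinv]
    generalize dieudonne ψ 1 (e : Matrix (Fin 1) (Fin 1) R) = t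
    generalize dieudonne ψ n s = a
    generalize dieudonne ψ n s' = b
    generalize dieudonne ψ 1 (d : Matrix (Fin 1) (Fin 1) R) = c
    rw [mul_comm c t]
    simp only [mul_assoc]
    congr 1
    rw [mul_left_comm b t, inv_mul_cancel_left, mul_left_comm]

/-- With multiplicativity in every size now available, the row induction runs for all `k`; its `1 ×
k` input is `DieudonneSwap.right_one` read backwards. -/
theorem dieudonneSwap (hε : ∀ x, ε x = 1 → IsUnit x) {ψ : oneFibre ε →* Q}
    (hψ : ∀ g ∈ commSet ε, ψ g = 1) (m k : ℕ) : DieudonneSwap ψ m k := by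
  induction m with
  | zero => exact .zero ψ k
  | succ m ih =>
    exact ih.succ hε (fun _ _ => dieudonne_mul hε hψ) fun x y h =>
      (DieudonneSwap.right_one hε hψ k y x h.symm).symm

theorem dieudonne_conj (hε : ∀ x, ε x = 1 → IsUnit x) {ψ : oneFibre ε →* Q}
    (hψ : ∀ g ∈ commSet ε, ψ g = 1) {n : ℕ} (g : (Matrix (Fin n) (Fin n) R)ˣ)
    {M : Matrix (Fin n) (Fin n) R} (hM : M.map ε = 1) :
    dieudonne ψ n (g * M * (↑g⁻¹ : Matrix (Fin n) (Fin n) R)) = dieudonne ψ n M := by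
  have h₀ : (M - 1).map ε = 0 := by
    rw [Matrix.map_sub _ (map_sub ε), hM, Matrix.map_one _ (map_zero ε) (map_one ε), sub_self]
  have h : ((g : Matrix (Fin n) (Fin n) R) * (M - 1)).map ε = 0 := by
    rw [Matrix.map_mul, h₀, Matrix.mul_zero]
  -- The factors are `g(M - 1)` and `g⁻¹`. Only the first vanishes under `ε`, which is why
  -- `DieudonneSwap` asks this of just one factor.
  have := dieudonneSwap hε hψ n n _ (↑g⁻¹ : Matrix (Fin n) (Fin n) R) (Or.inl h)
  rwa [units_inv_mul_mul, add_sub_cancel, mul_sub, sub_mul, mul_one, Units.mul_inv,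
    add_sub_cancel] at this

theorem dieudonne_stabMatrix (ψ : oneFibre ε →* Q) {n m : ℕ} (hnm : n ≤ m)
    (M : Matrix (Fin n) (Fin n) R) : dieudonne ψ m (stabMatrix n m M) = dieudonne ψ n M := by
  induction m, hnm using Nat.le_induction with
  | base => congr 1; ext i j; simp [stabMatrix]
  | succ m hm ih =>
    have : stabMatrix n (m + 1) M = stabMatrix m (m + 1) (stabMatrix n m M) := by
      ext i j
      simp only [stabMatrix, Matrix.of_apply]
      by_cases hn : (i : ℕ) < n ∧ (j : ℕ) < n
      · rw [dif_pos hn, dif_pos ⟨by omega, by omega⟩, dif_pos hn]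
      · simp [hn, Fin.ext_iff]
    have h' : Matrix.fromBlocks (stabMatrix n m M) 0 0 (1 : Matrix (Fin 1) (Fin 1) R) =
        gaussMatrix 0 (stabMatrix n m M) 1 0 := by
      simp [gaussMatrix]
    rw [this, stabMatrix_eq, h', dieudonne_gaussMatrix _ _ _ isUnit_one, ih, dieudonne_matrix_one,
      mul_one]

end Det

/-! ### Classes of invertible matrices in `K₁` -/

section Classes

variable {R : Type*} [Ring R]

theorem StableGL.of_stab {n m : ℕ} (h : n ≤ m) (g : (Matrix (Fin n) (Fin n) R)ˣ) :
    StableGL.of R m (stab R n m h g) = StableGL.of R n g := by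
  have := DirectLimit.eq_of_le (f := stab R) ⟨n, g⟩ m h
  exact this.symm

variable {ι κ : Type*} [Fintype ι] [DecidableEq ι] [Fintype κ] [DecidableEq κ]

/-- The class in `K₁(R)` of an invertible matrix with rows and columns indexed by a finite type. -/
def K1.ofMatrix (ι : Type*) [Fintype ι] [DecidableEq ι] : (Matrix ι ι R)ˣ →* K1 R :=
  Abelianization.of.comp ((StableGL.of R (Fintype.card ι)).comp
    (Units.map (Matrix.reindexRingEquiv R (Fintype.equivFin ι) : _ →* _)))

/-- The permutation matrix of `e`, as an invertible matrix. -/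
def permUnit (R : Type*) [Ring R] (e : ι ≃ ι) : (Matrix ι ι R)ˣ where
  val := (1 : Matrix ι ι R).submatrix e.symm id
  inv := (1 : Matrix ι ι R).submatrix id e.symm
  val_inv := by rw [← Matrix.submatrix_mul _ _ _ _ _ Function.bijective_id]; simp
  inv_val := by rw [← Matrix.submatrix_mul _ _ _ _ _ e.symm.bijective]; simp

theorem eq_permUnit_conj (e : ι ≃ ι) {U V : (Matrix ι ι R)ˣ}
    (h : (V : Matrix ι ι R) = Matrix.reindex e e (U : Matrix ι ι R)) :
    V = permUnit R e * U * (permUnit R e)⁻¹ := by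
  rw [eq_mul_inv_iff_mul_eq]
  ext i j
  simp only [permUnit, h, Units.val_mul, Matrix.mul_apply, Matrix.one_apply, Matrix.reindex_apply,
    Matrix.submatrix_apply, id, mul_ite, mul_one, mul_zero, ite_mul, one_mul, zero_mul]
  rw [Equiv.sum_comp e.symm fun k => if k = j then (U : Matrix ι ι R) (e.symm i) k else 0]
  simp

/-- Two enumerations of `ι` differ by a permutation, which acts by conjugation and so is invisible
in an abelian group. -/
theorem K1.ofMatrix_eq_of {n : ℕ} (e : ι ≃ Fin n) {U : (Matrix ι ι R)ˣ}
    {V : (Matrix (Fin n) (Fin n) R)ˣ}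
    (h : (V : Matrix (Fin n) (Fin n) R) = Matrix.reindex e e (U : Matrix ι ι R)) :
    K1.ofMatrix ι U = Abelianization.of (StableGL.of R n V) := by
  obtain rfl : n = Fintype.card ι := by rw [Fintype.card_congr e, Fintype.card_fin]
  rw [eq_permUnit_conj ((Fintype.equivFin ι).symm.trans e)
    (U := Units.map (Matrix.reindexRingEquiv R (Fintype.equivFin ι) : _ →* _) U) (V := V)
    (by rw [h]; ext; simp), map_mul, map_mul, map_mul, map_mul, map_inv, map_inv,
    mul_inv_cancel_comm]
  rfl

theorem K1.ofMatrix_reindex (e : ι ≃ κ) {U : (Matrix ι ι R)ˣ} {V : (Matrix κ κ R)ˣ}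
    (h : (V : Matrix κ κ R) = Matrix.reindex e e (U : Matrix ι ι R)) :
    K1.ofMatrix κ V = K1.ofMatrix ι U := by
  rw [K1.ofMatrix_eq_of (e.trans (Fintype.equivFin κ)) (U := U)
    (V := Units.map (Matrix.reindexRingEquiv R (Fintype.equivFin κ) : _ →* _) V)
    (by simp [h])]
  rfl

theorem K1.ofMatrix_fin {n : ℕ} (U : (Matrix (Fin n) (Fin n) R)ˣ) :
    K1.ofMatrix (Fin n) U = Abelianization.of (StableGL.of R n U) :=
  K1.ofMatrix_eq_of (Equiv.refl _) (by simp)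

/-- The block sum of two invertible matrices. -/
def blockUnit (g : (Matrix ι ι R)ˣ) (h : (Matrix κ κ R)ˣ) : (Matrix (ι ⊕ κ) (ι ⊕ κ) R)ˣ where
  val := Matrix.fromBlocks g 0 0 h
  inv := Matrix.fromBlocks ↑g⁻¹ 0 0 ↑h⁻¹
  val_inv := by simp [Matrix.fromBlocks_multiply]
  inv_val := by simp [Matrix.fromBlocks_multiply]

/-- The block unipotent matrix `[[1, x], [0, 1]]`. -/
def upperUnit (x : Matrix ι κ R) : (Matrix (ι ⊕ κ) (ι ⊕ κ) R)ˣ where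
  val := Matrix.fromBlocks 1 x 0 1
  inv := Matrix.fromBlocks 1 (-x) 0 1
  val_inv := by simp [Matrix.fromBlocks_multiply]
  inv_val := by simp [Matrix.fromBlocks_multiply]

/-- The block unipotent matrix `[[1, 0], [y, 1]]`. -/
def lowerUnit (y : Matrix κ ι R) : (Matrix (ι ⊕ κ) (ι ⊕ κ) R)ˣ where
  val := Matrix.fromBlocks 1 0 y 1
  inv := Matrix.fromBlocks 1 0 (-y) 1
  val_inv := by simp [Matrix.fromBlocks_multiply]
  inv_val := by simp [Matrix.fromBlocks_multiply]

theorem K1.ofMatrix_blockUnit_one_right (g : (Matrix ι ι R)ˣ) :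
    K1.ofMatrix (ι ⊕ κ) (blockUnit g 1) = K1.ofMatrix ι g := by
  set n := Fintype.card ι
  set d := Fintype.card κ
  set g' : (Matrix (Fin n) (Fin n) R)ˣ :=
    Units.map (Matrix.reindexRingEquiv R (Fintype.equivFin ι) : _ →* _) g
  rw [K1.ofMatrix_eq_of (((Fintype.equivFin ι).sumCongr (Fintype.equivFin κ)).trans finSumFinEquiv)
    (V := stab R n (n + d) (Nat.le_add_right n d) g'), StableGL.of_stab]
  · rfl
  · refine (stabMatrix_eq n d _).trans ?_
    have : Matrix.fromBlocks (g' : Matrix (Fin n) (Fin n) R) 0 0 (1 : Matrix (Fin d) (Fin d) R) =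
        Matrix.reindex ((Fintype.equivFin ι).sumCongr (Fintype.equivFin κ))
          ((Fintype.equivFin ι).sumCongr (Fintype.equivFin κ))
          (Matrix.fromBlocks (g : Matrix ι ι R) 0 0 (1 : Matrix κ κ R)) := by
      ext (i | i) (j | j) <;> simp [g', Matrix.one_apply]
    rw [this]
    rfl

theorem K1.ofMatrix_blockUnit_one_left (g : (Matrix ι ι R)ˣ) :
    K1.ofMatrix (κ ⊕ ι) (blockUnit 1 g) = K1.ofMatrix ι g := by
  rw [← K1.ofMatrix_blockUnit_one_right (κ := κ) g]
  refine K1.ofMatrix_reindex (Equiv.sumComm ι κ) ?_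
  simp [blockUnit]

theorem K1.ofMatrix_blockUnit (g : (Matrix ι ι R)ˣ) (h : (Matrix κ κ R)ˣ) :
    K1.ofMatrix (ι ⊕ κ) (blockUnit g h) = K1.ofMatrix ι g * K1.ofMatrix κ h := by
  rw [← K1.ofMatrix_blockUnit_one_right (κ := κ) g, ← K1.ofMatrix_blockUnit_one_left (κ := ι) h,
    ← map_mul]
  congr 1
  ext1
  simp [blockUnit, Matrix.fromBlocks_multiply]

/-- The two unipotents are conjugate by `1 ⊕ h`. -/
theorem K1.ofMatrix_upperUnit_mul (z : Matrix ι κ R) (h : (Matrix κ κ R)ˣ) :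
    K1.ofMatrix (ι ⊕ κ) (upperUnit (z * (h : Matrix κ κ R))) =
      K1.ofMatrix (ι ⊕ κ) (upperUnit z) := by
  have : upperUnit z * blockUnit 1 h = blockUnit 1 h * upperUnit (z * (h : Matrix κ κ R)) := by
    ext1
    simp [blockUnit, upperUnit, Matrix.fromBlocks_multiply]
  have := congrArg (K1.ofMatrix (ι ⊕ κ)) this
  rw [map_mul, map_mul, mul_comm] at this
  exact (mul_left_cancel this).symm

theorem K1.ofMatrix_upperUnit (x : Matrix ι κ R) : K1.ofMatrix (ι ⊕ κ) (upperUnit x) = 1 := by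
  -- With `z = (x, 0)` and `h = [[1, 1], [0, 1]]` one has `zh = (x, x)`. Since `zh` and `z` have the
  -- same class, the factor `(0, x)` has trivial class; up to reindexing it is a stabilization of
  -- `upperUnit x`.
  have h₁ : upperUnit (Matrix.fromCols x (0 : Matrix ι κ R) *
      (upperUnit (1 : Matrix κ κ R) : Matrix (κ ⊕ κ) (κ ⊕ κ) R)) =
      upperUnit (Matrix.fromCols x 0) * upperUnit (Matrix.fromCols (0 : Matrix ι κ R) x) := by
    ext1
    have : Matrix.fromCols x (0 : Matrix ι κ R) *
        (upperUnit (1 : Matrix κ κ R) : Matrix (κ ⊕ κ) (κ ⊕ κ) R) =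
        Matrix.fromCols (0 : Matrix ι κ R) x + Matrix.fromCols x 0 := by
      rw [upperUnit, Matrix.fromCols_mul_fromBlocks]
      ext i (j | j) <;> simp
    rw [this]
    simp [upperUnit, Matrix.fromBlocks_multiply]
  have h₂ := K1.ofMatrix_upperUnit_mul (Matrix.fromCols x (0 : Matrix ι κ R)) (upperUnit 1)
  rw [h₁, map_mul, mul_eq_left] at h₂
  rw [← h₂, ← K1.ofMatrix_blockUnit_one_right (κ := κ)]
  symm
  refine K1.ofMatrix_reindex
    ((Equiv.sumAssoc ι κ κ).trans ((Equiv.refl ι).sumCongr (Equiv.sumComm κ κ))) ?_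
  ext (i | i | i) (j | j | j) <;> simp [upperUnit, blockUnit, Matrix.one_apply]

theorem K1.ofMatrix_lowerUnit (y : Matrix κ ι R) : K1.ofMatrix (ι ⊕ κ) (lowerUnit y) = 1 := by
  rw [← K1.ofMatrix_upperUnit y]
  refine K1.ofMatrix_reindex (Equiv.sumComm κ ι) ?_
  simp [upperUnit, lowerUnit]

/-- Both `u ⊕ 1` and `1 ⊕ v` are reduced to `[[1, a], [-b, 1]]` by unipotent factors, whose classes
are trivial. -/
theorem K1.ofMatrix_one_add_mul_comm {a : Matrix ι κ R} {b : Matrix κ ι R}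
    {u : (Matrix ι ι R)ˣ} {v : (Matrix κ κ R)ˣ} (hu : (u : Matrix ι ι R) = 1 + a * b)
    (hv : (v : Matrix κ κ R) = 1 + b * a) : K1.ofMatrix ι u = K1.ofMatrix κ v := by
  have : upperUnit a * blockUnit u 1 * lowerUnit (-b) =
      lowerUnit (-b) * blockUnit 1 v * upperUnit a := by
    ext1
    simp [upperUnit, lowerUnit, blockUnit, Matrix.fromBlocks_multiply, hu, hv]
  have := congrArg (K1.ofMatrix (ι ⊕ κ)) this
  simpa only [map_mul, K1.ofMatrix_upperUnit, K1.ofMatrix_lowerUnit, one_mul, mul_one,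
    K1.ofMatrix_blockUnit_one_left, K1.ofMatrix_blockUnit_one_right] using this

/-- A unit of `R` as an invertible `1 × 1` matrix. -/
def scalarUnit (R : Type*) [Ring R] : Rˣ →* (Matrix (Fin 1) (Fin 1) R)ˣ :=
  Units.map (Matrix.scalar (Fin 1) : R →+* Matrix (Fin 1) (Fin 1) R)

theorem K1.ofUnit_eq (u : Rˣ) : K1.ofUnit R u = K1.ofMatrix (Fin 1) (scalarUnit R u) :=
  (K1.ofMatrix_fin _).symm

theorem K1.ofUnit_one_add_mul_comm {a b : R} {u v : Rˣ} (hu : (u : R) = 1 + a * b)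
    (hv : (v : R) = 1 + b * a) : K1.ofUnit R u = K1.ofUnit R v := by
  rw [K1.ofUnit_eq, K1.ofUnit_eq]
  refine K1.ofMatrix_one_add_mul_comm (a := Matrix.scalar (Fin 1) a)
    (b := Matrix.scalar (Fin 1) b) ?_ ?_
  · rw [← map_mul, ← map_one (Matrix.scalar (Fin 1)), ← map_add, ← hu]; rfl
  · rw [← map_mul, ← map_one (Matrix.scalar (Fin 1)), ← map_add, ← hv]; rfl

theorem K1.exists_eq_of (x : K1 R) : ∃ n g, x = Abelianization.of (StableGL.of R n g) := by
  obtain ⟨y, rfl⟩ := QuotientGroup.mk_surjective x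
  obtain ⟨n, g, rfl⟩ := DirectLimit.exists_eq_mk (stab R) y
  exact ⟨n, g, rfl⟩

end Classes

/-! ### The splitting of `K₁` along a split homomorphism -/

section Splitting

variable {R S : Type*} [Ring R] [Ring S] {ε : R →+* S}

/-- The map `GL_n(R) → GL_n(S)` applying a ring homomorphism entrywise. -/
def glMap (f : R →+* S) (n : ℕ) : (Matrix (Fin n) (Fin n) R)ˣ →* (Matrix (Fin n) (Fin n) S)ˣ :=
  Units.map (f.mapMatrix : Matrix (Fin n) (Fin n) R →+* Matrix (Fin n) (Fin n) S)

theorem glMap_stab (f : R →+* S) {n m : ℕ} (h : n ≤ m) (g : (Matrix (Fin n) (Fin n) R)ˣ) :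
    glMap f m (stab R n m h g) = stab S n m h (glMap f n g) := by
  ext i j
  simp only [glMap, stab, stabMatrix, Units.coe_map, MonoidHom.coe_mk, OneHom.coe_mk,
    MonoidHom.coe_coe, RingHom.mapMatrix_apply, Matrix.map_apply, Matrix.of_apply]
  split_ifs <;> simp

theorem K1.map_of (f : R →+* S) (n : ℕ) (g : (Matrix (Fin n) (Fin n) R)ˣ) :
    K1.map f (Abelianization.of (StableGL.of R n g)) =
      Abelianization.of (StableGL.of S n (glMap f n g)) := rfl

theorem K1.map_ofUnit (f : R →+* S) (u : Rˣ) :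
    K1.map f (K1.ofUnit R u) = K1.ofUnit S (Units.map (f : R →* S) u) := by
  refine (K1.map_of f 1 _).trans (congrArg (fun g => Abelianization.of (StableGL.of S 1 g)) ?_)
  ext i j
  simp [glMap, Subsingleton.elim i j]




theorem glMap_section {s : S →+* R} (hs : ε.comp s = RingHom.id S) (n : ℕ)
    (g : (Matrix (Fin n) (Fin n) S)ˣ) :
    glMap ε n (glMap s n g) = g := by
  ext i j
  exact RingHom.congr_fun hs _

theorem K1.map_section {s : S →+* R} (hs : ε.comp s = RingHom.id S) (x : K1 S) :
    K1.map ε (K1.map s x) = x := by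
  obtain ⟨n, g, rfl⟩ := K1.exists_eq_of x
  rw [K1.map_of, K1.map_of, glMap_section hs]

section Determinant

variable {Q : Type*} [CommGroup Q] (hε : ∀ x, ε x = 1 → IsUnit x) {s : S →+* R}
  (hs : ε.comp s = RingHom.id S) {ψ : oneFibre ε →* Q} (hψ : ∀ g ∈ commSet ε, ψ g = 1)

/-- The component of `g` in the kernel of `GL_n(R) → GL_n(S)`, along the splitting `s`. -/
def glKernelPart (ε : R →+* S) (s : S →+* R) (n : ℕ) (g : (Matrix (Fin n) (Fin n) R)ˣ) :
    (Matrix (Fin n) (Fin n) R)ˣ :=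
  g * (glMap s n (glMap ε n g))⁻¹

theorem glKernelPart_map (hs : ε.comp s = RingHom.id S) (n : ℕ)
    (g : (Matrix (Fin n) (Fin n) R)ˣ) :
    (glKernelPart ε s n g : Matrix (Fin n) (Fin n) R).map ε = 1 := by
  have : glMap ε n (glKernelPart ε s n g) = 1 := by
    rw [glKernelPart, map_mul, map_inv, glMap_section hs, mul_inv_cancel]
  exact congrArg Units.val this

/-- The homomorphism `GL_n(R) → Q` extending the Dieudonné determinant by `1` on the image
of `GL_n(S)`. -/
def glDet (hε : ∀ x, ε x = 1 → IsUnit x) (hs : ε.comp s = RingHom.id S)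
    (hψ : ∀ g ∈ commSet ε, ψ g = 1) (n : ℕ) : (Matrix (Fin n) (Fin n) R)ˣ →* Q :=
  MonoidHom.mk' (fun g => dieudonne ψ n (glKernelPart ε s n g : Matrix (Fin n) (Fin n) R))
    fun g h => by
      set k := glMap s n (glMap ε n g)
      -- The kernel part is a crossed homomorphism for conjugation by the image of `GL_n(S)`;
      -- `dieudonne_conj` removes the twist.
      have e : glKernelPart ε s n (g * h) =
          glKernelPart ε s n g * (k * glKernelPart ε s n h * k⁻¹) := by
        simp only [glKernelPart, map_mul, k]
        group
      have hk : (k * glKernelPart ε s n h * k⁻¹ : Matrix (Fin n) (Fin n) R).map ε = 1 := by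
        have : glMap ε n (k * glKernelPart ε s n h * k⁻¹) = 1 := by
          have h₁ : glMap ε n (glKernelPart ε s n h) = 1 := Units.ext (glKernelPart_map hs n h)
          rw [map_mul, map_mul, h₁, mul_one, map_inv, mul_inv_cancel]
        exact congrArg Units.val this
      rw [e, Units.val_mul, Units.val_mul, Units.val_mul,
        dieudonne_mul hε hψ (glKernelPart_map hs n g) hk,
        dieudonne_conj hε hψ k (glKernelPart_map hs n h)]

theorem glDet_apply (n : ℕ) (g : (Matrix (Fin n) (Fin n) R)ˣ) :
    glDet hε hs hψ n g = dieudonne ψ n (glKernelPart ε s n g : Matrix (Fin n) (Fin n) R) := rfl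

theorem glDet_stab {n m : ℕ} (h : n ≤ m) (g : (Matrix (Fin n) (Fin n) R)ˣ) :
    glDet hε hs hψ m (stab R n m h g) = glDet hε hs hψ n g := by
  have : glKernelPart ε s m (stab R n m h g) = stab R n m h (glKernelPart ε s n g) := by
    rw [glKernelPart, glKernelPart, glMap_stab, glMap_stab, map_mul, map_inv]
  rw [glDet_apply, glDet_apply, this]
  exact dieudonne_stabMatrix ψ h _

/-- The Dieudonné determinant on the stable general linear group. -/
def stableDet : StableGL R →* Q where
  toFun := DirectLimit.lift (stab R) (fun n => glDet hε hs hψ n)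
    fun _ _ h g => (glDet_stab hε hs hψ h g).symm
  map_one' := by
    rw [DirectLimit.one_def 0, DirectLimit.lift_def, map_one]
  map_mul' := by
    refine DirectLimit.induction₂ _ fun n g h => ?_
    rw [DirectLimit.mul_def, DirectLimit.lift_def, DirectLimit.lift_def, DirectLimit.lift_def,
      map_mul]

/-- The Dieudonné determinant on `K₁(R)`. -/
def K1.det : K1 R →* Q := Abelianization.lift (stableDet hε hs hψ)

theorem K1.det_of (n : ℕ) (g : (Matrix (Fin n) (Fin n) R)ˣ) :
    K1.det hε hs hψ (Abelianization.of (StableGL.of R n g)) =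
      dieudonne ψ n (glKernelPart ε s n g : Matrix (Fin n) (Fin n) R) := rfl

theorem K1.det_section (x : K1 S) : K1.det hε hs hψ (K1.map s x) = 1 := by
  obtain ⟨n, g, rfl⟩ := K1.exists_eq_of x
  rw [K1.map_of, K1.det_of, glKernelPart, glMap_section hs, mul_inv_cancel, Units.val_one,
    dieudonne_matrix_one]

theorem K1.det_ofUnit (u : oneFibre ε) : K1.det hε hs hψ (K1.ofUnit R u) = ψ u := by
  have h : glMap ε 1 (scalarUnit R u) = 1 := by
    ext i j
    simp [glMap, scalarUnit, Subsingleton.elim i j, map_oneFibre]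
  refine (K1.det_of hε hs hψ 1 (scalarUnit R u)).trans ?_
  rw [glKernelPart, h, map_one, inv_one, mul_one, dieudonne_one, ← unitDet_coe]
  simp [scalarUnit]

end Determinant

/-- Gaussian elimination again: the unipotent factors die in `K₁`, and the class is that of the
product of the pivots. -/
theorem K1.exists_ofUnit_eq_ofMatrix (hε : ∀ x, ε x = 1 → IsUnit x) {n : ℕ}
    (g : (Matrix (Fin n) (Fin n) R)ˣ) (hg : (g : Matrix (Fin n) (Fin n) R).map ε = 1) :
    ∃ u : oneFibre ε, K1.ofMatrix (Fin n) g = K1.ofUnit R u := by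
  induction n with
  | zero =>
    refine ⟨1, ?_⟩
    rw [Subsingleton.elim g 1, map_one, Subgroup.coe_one, map_one]
  | succ n ih =>
    set g' : (Matrix (Fin n ⊕ Fin 1) (Fin n ⊕ Fin 1) R)ˣ :=
      Units.map (Matrix.reindexRingEquiv R (finSumFinEquiv (m := n) (n := 1)).symm : _ →* _) g
    have hgg : (g' : Matrix (Fin n ⊕ Fin 1) (Fin n ⊕ Fin 1) R) =
      Matrix.reindex finSumFinEquiv.symm finSumFinEquiv.symm
        (g : Matrix (Fin (n + 1)) (Fin (n + 1)) R) := rfl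
    have hmap : (g' : Matrix (Fin n ⊕ Fin 1) (Fin n ⊕ Fin 1) R).map ε = 1 := by
      rwa [hgg, map_reindex_eq_one]
    obtain ⟨x, t, d, y, -, ht, hd, -, h⟩ :=
      exists_gaussMatrix_of_map_eq_one (isUnit_of_map_eq_one_fin_one hε) hmap
    obtain ⟨t, rfl⟩ := isUnit_of_map_eq_one hε t ht
    obtain ⟨u, hu⟩ := ih t ht
    obtain ⟨v, hv⟩ := exists_oneFibre hε (x := (d : Matrix (Fin 1) (Fin 1) R) 0 0)
      (by simpa using congrFun (congrFun hd 0) 0)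
    have hdv : d = scalarUnit R v := by
      ext i j
      simp [scalarUnit, hv, Subsingleton.elim i 0, Subsingleton.elim j 0]
    have hfac : g' = upperUnit x * blockUnit t d * lowerUnit y :=
      Units.ext (h.trans (gaussMatrix_eq _ _ _ _))
    refine ⟨u * v, ?_⟩
    rw [← K1.ofMatrix_reindex _ hgg, hfac, map_mul, map_mul, K1.ofMatrix_upperUnit,
      K1.ofMatrix_lowerUnit, K1.ofMatrix_blockUnit, hu, hdv, ← K1.ofUnit_eq, one_mul, mul_one,
      Subgroup.coe_mul, map_mul]

theorem K1.ofUnit_eq_one_of_mem_commC {u : oneFibre ε} (hu : u ∈ commC ε) :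
    K1.ofUnit R u = 1 := by
  have : commC ε ≤ ((K1.ofUnit R).comp (oneFibre ε).subtype).ker := by
    refine (Subgroup.closure_le _).2 ?_
    rintro g ⟨a, b, u, v, -, -, hu, hv, hg⟩
    change K1.ofUnit R (g : Rˣ) = 1
    rw [hg, map_mul, map_inv, K1.ofUnit_one_add_mul_comm hu hv, mul_inv_cancel]
  exact this hu

theorem commC_quotient_mul_comm (x y : oneFibre ε ⧸ commC ε) : x * y = y * x := by
  obtain ⟨u, rfl⟩ := QuotientGroup.mk_surjective x
  obtain ⟨v, rfl⟩ := QuotientGroup.mk_surjective y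
  rw [← QuotientGroup.mk_mul, ← QuotientGroup.mk_mul, eq_comm, QuotientGroup.eq_iff_div_mem,
    div_eq_mul_inv]
  -- For `a = v` and `b = u - v⁻¹` one gets `1 + ab = vu`, `1 + ba = uv` and `ε b = 0`; hence `C`
  -- contains all commutators.
  refine Subgroup.subset_closure ⟨(v : Rˣ), (u : Rˣ) - ((v⁻¹ : oneFibre ε) : Rˣ),
    (v * u : oneFibre ε), (u * v : oneFibre ε), ?_, ?_, ?_, ?_, rfl⟩
  · rw [map_mul, map_sub, map_oneFibre, map_oneFibre, map_oneFibre, sub_self, mul_zero]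
  · rw [map_mul, map_sub, map_oneFibre, map_oneFibre, map_oneFibre, sub_self, zero_mul]
  · simp [mul_sub]
  · simp [sub_mul]

/-- If `ε : R → S` is split and `ε⁻¹(1)` consists of units, then
`K₁(R) ≅ K₁(S) × ε⁻¹(1) / C`. -/
theorem K1.exists_mulEquiv_prod (hε : ∀ x, ε x = 1 → IsUnit x) {s : S →+* R}
    (hs : ε.comp s = RingHom.id S) :
    ∃ Φ : K1 R ≃* K1 S × (oneFibre ε ⧸ commC ε),
      (∀ x : K1 S, Φ (K1.map s x) = (x, 1)) ∧
      (∀ u : oneFibre ε, Φ (K1.ofUnit R u) = (1, (u : oneFibre ε ⧸ commC ε))) := by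
  let _ : CommGroup (oneFibre ε ⧸ commC ε) :=
    { (inferInstance : Group (oneFibre ε ⧸ commC ε)) with mul_comm := commC_quotient_mul_comm }
  have hψ : ∀ g ∈ commSet ε, QuotientGroup.mk' (commC ε) g = 1 := fun g hg =>
    (QuotientGroup.eq_one_iff g).2 (Subgroup.subset_closure hg)
  set D := K1.det hε hs hψ
  set F : K1 R →* K1 S × (oneFibre ε ⧸ commC ε) := (K1.map ε).prod D with hF
  have h₁ : ∀ x : K1 S, F (K1.map s x) = (x, 1) := fun x =>
    Prod.ext (K1.map_section hs x) (K1.det_section hε hs hψ x)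
  have h₂ : ∀ u : oneFibre ε, F (K1.ofUnit R u) = (1, (u : oneFibre ε ⧸ commC ε)) := fun u => by
    refine Prod.ext ?_ (K1.det_ofUnit hε hs hψ u)
    refine (K1.map_ofUnit ε u).trans ?_
    rw [show Units.map (ε : R →* S) u = 1 from u.2, map_one]
  refine ⟨MulEquiv.ofBijective F ⟨?_, ?_⟩, h₁, h₂⟩
  · refine (injective_iff_map_eq_one F).2 fun x hx => ?_
    obtain ⟨n, g, rfl⟩ := K1.exists_eq_of x
    obtain ⟨u, hu⟩ := K1.exists_ofUnit_eq_ofMatrix hε _ (glKernelPart_map hs n g)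
    rw [K1.ofMatrix_fin] at hu
    have hεg := congrArg Prod.fst hx
    change K1.map ε _ = 1 at hεg
    -- The second factor has class `K1.map s (K1.map ε [g])`, trivial here, so `[g]` is the class of
    -- a unit `u`; the determinant component then puts `u` in `C`.
    have hg : g = glKernelPart ε s n g * glMap s n (glMap ε n g) := by
      rw [glKernelPart, inv_mul_cancel_right]
    have hgu : Abelianization.of (StableGL.of R n g) = K1.ofUnit R u := by
      conv_lhs => rw [hg]
      rw [map_mul, map_mul, hu, ← K1.map_of, ← K1.map_of, hεg, map_one, mul_one]
    rw [hgu] at hx ⊢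
    rw [h₂] at hx
    exact K1.ofUnit_eq_one_of_mem_commC ((QuotientGroup.eq_one_iff u).1 (congrArg Prod.snd hx))
  · rintro ⟨x, y⟩
    obtain ⟨u, rfl⟩ := QuotientGroup.mk_surjective y
    exact ⟨K1.map s x * K1.ofUnit R u, by rw [map_mul, h₁, h₂, Prod.mk_mul_mk, mul_one, one_mul]⟩

end Splitting

theorem augLoc_comp_coeffMap (A : Type*) [Ring A] (π : Type*) [Group π] :
    (augLoc A π).comp (coeffMap A π) = RingHom.id A := by
  ext a
  exact (augLoc_of A π _).trans (augmentation_single A π 1 a)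

end

end GroupRingK1

open GroupRingK1 in
theorem mainTheorem3 (A : Type*) [Ring A] (π : Type*) [Group π] :
    (∀ x : AugLoc A π, augLoc A π x = 1 → IsUnit x) ∧
    ∃ Φ : K1 (AugLoc A π) ≃* K1 A × (oneFibre (augLoc A π) ⧸ commC (augLoc A π)),
      (∀ x : K1 A, Φ (K1.map (coeffMap A π) x) = (x, 1)) ∧
      (∀ u : oneFibre (augLoc A π),
        Φ (K1.ofUnit (AugLoc A π) u) = (1, (u : oneFibre (augLoc A π) ⧸ commC (augLoc A π)))) := by
  have hε : ∀ x : AugLoc A π, augLoc A π x = 1 → IsUnit x := fun x hx =>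
    isUnit_of_isUnit_augLoc A π (hx ▸ isUnit_one)
  exact ⟨hε, K1.exists_mulEquiv_prod hε (augLoc_comp_coeffMap A π)⟩
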